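/- Let $A_1,A_2$ be unital $C^*$-algebras and let $\theta_i$ be a $\mathbb Z_2$-grading of $A_i$, i.e. a $*$-automorphism with $\theta_i^2=\mathrm{id}$; write $A_{i,0}=\{a:\theta_i(a)=a\}$ and $A_{i,1}=\{a:\theta_i(a)=-a\}$, so that $A_i=A_{i,0}\oplus A_{i,1}$. The (algebraic) Fermi product $A_1\,Ⓕ\,A_2$ is the algebraic tensor product $A_1\odot A_2$ with the $*$-algebra structure determined by $$(a\otimes b)(a'\otimes b')=(-1)^{jk}\,aa'\otimes bb',\qquad (a\otimes b)^*=(-1)^{ij}\,a^*\otimes b^*$$ for $a\in A_{1,i}$, $b\in A_{2,j}$, $a'\in A_{1,k}$, $b'\in A_{2,l}$ ($i,j,k,l\in\{0,1\}$). A state $\omega$ of $A_i$ is even if $\omega\circ\theta_i=\omega$. For states $\omega_1$ of $A_1$ and $\omega_2$ of $A_2$, let $\omega_1\times\omega_2$ be the linear functional on $A_1\,Ⓕ\,A_2$ with $(\omega_1\times\omega_2)(a\otimes b)=\omega_1(a)\omega_2(b)$. If $\omega_1$ and $\omega_2$ are even, then $\omega_1\times\omega_2$ is a state (unital, and nonnegative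 on all $x^*x$), and it has a GNS representation $\pi_{\omega_1\times\omega_2}$ by bounded operators, i.e. a $*$-representation on a Hilbert space with a cyclic vector $\xi$ such that $(\omega_1\times\omega_2)(x)=\langle\xi,\pi_{\omega_1\times\omega_2}(x)\xi\rangle$ for all $x$. For every $x\in A_1\,Ⓕ\,A_2$ the supremum $$\|x\|_{\min}:=\sup\{\|\pi_{\omega_1\times\omega_2}(x)\| : \omega_1,\omega_2 \text{ even states of } A_1,A_2\}$$ is finite (it is read as $0$ if there are no states, i.e. if $A_1$ or $A_2$ is zero), and $\|\cdot\|_{\min}$ is a $C^*$-norm on $A_1\,Ⓕ\,A_2$: it is a norm on this complex vector space (in particular $\|x\|_{\min}=0$ only for $x=0$), and $\|xy\|_{\min}\le\|x\|_{\min}\|y\|_{\min}$ and $\|x^*x\|_{\min}=\|x\|_{\min}^2$ for all $x,y$. -/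

import Mathlib

open scoped TensorProduct ComplexOrder DirectSum

universe u v w

noncomputable section

/-- A `ℤ₂`-grading of a unital `*`-algebra, given by an involutive `*`-automorphism. -/
structure Z2Grading (A : Type u) [Ring A] [StarRing A] [Algebra ℂ A] where
  θ : A ≃⋆ₐ[ℂ] A
  involutive : ∀ a, θ (θ a) = a

namespace Z2Grading

variable {A : Type u} [Ring A] [StarRing A] [Algebra ℂ A] (g : Z2Grading A)

/-- The homogeneous components: `part 0` is the even part `{a | θ a = a}`, and `part 1` is the odd
part `{a | θ a = -a}`. -/
def part (i : ZMod 2) : Submodule ℂ A where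
  carrier := {a | g.θ a = (-1 : ℤˣ) ^ i • a}
  add_mem' {a b} ha hb := by
    simp only [Set.mem_ofPred_eq] at *
    rw [map_add, ha, hb, smul_add]
  zero_mem' := by simp
  smul_mem' c a ha := by
    simp only [Set.mem_ofPred_eq] at *
    rw [map_smul, ha, smul_comm]

theorem mem_part {i : ZMod 2} {a : A} : a ∈ g.part i ↔ g.θ a = (-1 : ℤˣ) ^ i • a := Iff.rfl

theorem mem_part_zero {a : A} : a ∈ g.part 0 ↔ g.θ a = a := by
  rw [mem_part]; simp

theorem mem_part_one {a : A} : a ∈ g.part 1 ↔ g.θ a = -a := by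
  rw [mem_part]; simp

instance gradedMonoid : SetLike.GradedMonoid g.part where
  one_mem := by rw [mem_part_zero]; simp
  mul_mem i j a b ha hb := by
    rw [mem_part] at *
    rw [map_mul, ha, hb, uzpow_add, smul_mul_smul_comm]

/-- The projection `(id ± θ) / 2` onto a homogeneous component. -/
def proj (i : ZMod 2) : A →ₗ[ℂ] g.part i where
  toFun a := ⟨(2⁻¹ : ℂ) • (a + (-1 : ℤˣ) ^ i • g.θ a), by
    rw [mem_part, map_smul, map_add, smul_comm ((-1 : ℤˣ) ^ i)]
    congr 1
    rcases Int.units_eq_one_or ((-1 : ℤˣ) ^ i) with h | h <;>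
      simp [h, g.involutive, add_comm, Units.smul_def]⟩
  map_add' a b := by
    ext
    simp only [map_add, smul_add, Submodule.coe_add]
    abel
  map_smul' c a := by
    ext
    simp only [map_smul, RingHom.id_apply, Submodule.coe_smul]
    rw [smul_comm _ c, ← smul_add, smul_comm]

theorem coe_proj (i : ZMod 2) (a : A) :
    (g.proj i a : A) = (2⁻¹ : ℂ) • (a + (-1 : ℤˣ) ^ i • g.θ a) := rfl

theorem proj_add_proj (a : A) : (g.proj 0 a : A) + g.proj 1 a = a := by
  rw [coe_proj, coe_proj, ← smul_add]
  simp only [uzpow_zero, uzpow_one, one_smul, Units.smul_def, Units.val_neg, Units.val_one,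
    neg_smul]
  rw [show a + g.θ a + (a + -g.θ a) = (2 : ℂ) • a by rw [two_smul]; abel, smul_smul]
  norm_num

theorem proj_same {i : ZMod 2} (a : g.part i) : g.proj i (a : A) = a := by
  ext
  rw [coe_proj, (g.mem_part).1 a.2, smul_smul, Int.units_mul_self, one_smul, ← two_smul ℂ,
    smul_smul]
  norm_num

theorem proj_ne {i j : ZMod 2} (h : i ≠ j) (a : g.part i) : g.proj j (a : A) = 0 := by
  ext
  rw [coe_proj, (g.mem_part).1 a.2]
  have h2 : j = i + 1 := (by decide : ∀ i j : ZMod 2, i ≠ j → j = i + 1) i j h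
  subst h2
  rw [smul_smul, uzpow_add, uzpow_one, mul_assoc, mul_comm (-1 : ℤˣ), ← mul_assoc,
    Int.units_mul_self]
  simp [Units.smul_def]

/-- The decomposition `a = a₊ + a₋`. -/
instance gradedAlgebra : GradedAlgebra g.part where
  decompose' a := DirectSum.of (fun i => g.part i) 0 (g.proj 0 a) +
    DirectSum.of (fun i => g.part i) 1 (g.proj 1 a)
  left_inv a := by
    rw [map_add, DirectSum.coeAddMonoidHom_of, DirectSum.coeAddMonoidHom_of]
    exact g.proj_add_proj a
  right_inv x := by
    induction x using DirectSum.induction_on with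
    | zero => simp
    | of i a =>
      rw [DirectSum.coeAddMonoidHom_of]
      have hi : i = 0 ∨ i = 1 := (by decide : ∀ i : ZMod 2, i = 0 ∨ i = 1) i
      rcases hi with rfl | rfl
      · beta_reduce; rw [proj_same, proj_ne _ (by decide)]; simp
      · beta_reduce; rw [proj_same, proj_ne _ (by decide)]; simp
    | add x y hx hy =>
      refine Eq.trans ?_ (congrArg₂ (· + ·) hx hy)
      simp only [map_add]
      abel

theorem star_mem {i : ZMod 2} {a : A} (h : a ∈ g.part i) :
    star a ∈ g.part i := by
  rw [mem_part] at *
  rw [map_star, h, Units.smul_def, Units.smul_def, star_zsmul]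

end Z2Grading

section Fermi

variable {A₁ : Type u} {A₂ : Type v} [Ring A₁] [StarRing A₁] [Algebra ℂ A₁]
  [Ring A₂] [StarRing A₂] [Algebra ℂ A₂]

/-- The algebraic Fermi product: the vector space `A₁ ⊗ A₂` with the multiplication
`(a ⊗ b) (a' ⊗ b') = (-1) ^ (∂b ∂a') • (a a' ⊗ b b')` on homogeneous elements. -/
abbrev FermiProduct (g₁ : Z2Grading A₁) (g₂ : Z2Grading A₂) : Type (max u v) :=
  g₁.part ᵍ⊗[ℂ] g₂.part

namespace FermiProduct

variable (g₁ : Z2Grading A₁) (g₂ : Z2Grading A₂)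

/-- The linear map acting on `A₁,i ⊗ A₂,j` as multiplication by the sign `(-1) ^ (i j)`. -/
def signMap : A₁ ⊗[ℂ] A₂ →ₗ[ℂ] A₁ ⊗[ℂ] A₂ :=
  ∑ i : ZMod 2, ∑ j : ZMod 2, (((-1 : ℤˣ) ^ (i * j) : ℤˣ) : ℤ) •
    TensorProduct.map ((g₁.part i).subtype ∘ₗ g₁.proj i) ((g₂.part j).subtype ∘ₗ g₂.proj j)

theorem signMap_tmul {i j : ZMod 2} (a : g₁.part i) (b : g₂.part j) :
    signMap g₁ g₂ ((a : A₁) ⊗ₜ (b : A₂)) = (-1 : ℤˣ) ^ (i * j) • ((a : A₁) ⊗ₜ[ℂ] (b : A₂)) := by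
  simp only [signMap, LinearMap.sum_apply, LinearMap.smul_apply, TensorProduct.map_tmul,
    LinearMap.comp_apply, Submodule.subtype_apply]
  rw [Finset.sum_eq_single i, Finset.sum_eq_single j]
  · rw [g₁.proj_same, g₂.proj_same]; rfl
  · intro j' _ hj
    rw [g₂.proj_ne hj.symm]; simp
  · simp
  · intro i' _ hi
    rw [g₁.proj_ne hi.symm]; simp
  · simp

variable {g₁ g₂} in
/-- Induction on sums of elementary tensors of homogeneous elements. -/
theorem induction_homogeneous {P : FermiProduct g₁ g₂ → Prop} (x : FermiProduct g₁ g₂)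
    (zero : P 0)
    (tmul : ∀ (i j : ZMod 2) (a : g₁.part i) (b : g₂.part j), P ((a : A₁) ᵍ⊗ₜ[ℂ] (b : A₂)))
    (add : ∀ x y, P x → P y → P (x + y)) : P x := by
  have key : ∀ t : A₁ ⊗[ℂ] A₂, P (GradedTensorProduct.of ℂ g₁.part g₂.part t) := by
    intro t
    induction t using TensorProduct.induction_on with
    | zero => simpa using zero
    | tmul a b =>
      rw [← g₁.proj_add_proj a, ← g₂.proj_add_proj b]
      simp only [TensorProduct.add_tmul, TensorProduct.tmul_add, map_add]
      exact add _ _ (add _ _ (tmul _ _ _ _) (tmul _ _ _ _))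
        (add _ _ (tmul _ _ _ _) (tmul _ _ _ _))
    | add x y hx hy => rw [map_add]; exact add _ _ hx hy
  exact key ((GradedTensorProduct.of ℂ g₁.part g₂.part).symm x)

variable [StarModule ℂ A₁] [StarModule ℂ A₂]

/-- The involution `x* = ∑ i j, (-1) ^ (i j) • (x i j)*`, where `(a ⊗ b)* = a* ⊗ b*` on the right
hand side. -/
instance instStar : Star (FermiProduct g₁ g₂) where
  star x := GradedTensorProduct.of ℂ g₁.part g₂.part
    (signMap g₁ g₂ (star ((GradedTensorProduct.of ℂ g₁.part g₂.part).symm x)))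

variable {g₁ g₂} in
theorem star_tmul {i j : ZMod 2} (a : g₁.part i) (b : g₂.part j) :
    star ((a : A₁) ᵍ⊗ₜ[ℂ] (b : A₂) : FermiProduct g₁ g₂) =
      (-1 : ℤˣ) ^ (i * j) • (star (a : A₁) ᵍ⊗ₜ[ℂ] star (b : A₂)) :=
  signMap_tmul g₁ g₂ ⟨_, g₁.star_mem a.2⟩ ⟨_, g₂.star_mem b.2⟩

variable {g₁ g₂} in
theorem star_add' (x y : FermiProduct g₁ g₂) : star (x + y) = star x + star y := by
  simp only [star, map_add]

theorem star_units_smul (e : ℤˣ) (x : FermiProduct g₁ g₂) : star (e • x) = e • star x := by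
  have hneg : star (-x) = -star x := by simp only [star, map_neg]
  rcases Int.units_eq_one_or e with rfl | rfl
  · simp
  · simpa [Units.smul_def] using hneg

/-- The Fermi product is a unital `*`-algebra. -/
instance instStarRing : StarRing (FermiProduct g₁ g₂) where
  star_add := star_add'
  star_involutive x := by
    induction x using induction_homogeneous with
    | zero => simp [star]
    | tmul i j a b =>
      rw [star_tmul, star_units_smul,
        star_tmul ⟨_, g₁.star_mem a.2⟩ ⟨_, g₂.star_mem b.2⟩, smul_smul, Int.units_mul_self,
        one_smul, star_star, star_star]
    | add x y hx hy => rw [star_add', star_add', hx, hy]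
  star_mul x y := by
    induction x using induction_homogeneous with
    | zero => simp [star]
    | add x x' hx hx' => rw [add_mul, star_add', star_add', hx, hx', mul_add]
    | tmul i j a b =>
      induction y using induction_homogeneous with
      | zero => simp [star]
      | add y y' hy hy' => rw [mul_add, star_add', star_add', hy, hy', add_mul]
      | tmul k l c d =>
        rw [GradedTensorProduct.tmul_coe_mul_coe_tmul, star_units_smul,
          star_tmul ⟨_, SetLike.mul_mem_graded a.2 c.2⟩ ⟨_, SetLike.mul_mem_graded b.2 d.2⟩,
          star_tmul, star_tmul, smul_mul_smul_comm,
          GradedTensorProduct.tmul_coe_mul_coe_tmul g₁.part g₂.part (star (c : A₁))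
            ⟨_, g₂.star_mem d.2⟩ ⟨_, g₁.star_mem a.2⟩ (star (b : A₂)), smul_smul, smul_smul,
          star_mul, star_mul]
        congr 1
        exact (by decide : ∀ i j k l : ZMod 2,
          (-1 : ℤˣ) ^ (j * k) * (-1) ^ ((i + k) * (j + l)) =
            (-1) ^ (k * l) * (-1) ^ (i * j) * (-1) ^ (l * i)) i j k l

instance instStarModule : StarModule ℂ (FermiProduct g₁ g₂) where
  star_smul c x := by
    have h : star (c • (GradedTensorProduct.of ℂ g₁.part g₂.part).symm x) =
        star c • star ((GradedTensorProduct.of ℂ g₁.part g₂.part).symm x) := star_smul _ _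
    change GradedTensorProduct.of ℂ g₁.part g₂.part (signMap g₁ g₂
      (star (c • (GradedTensorProduct.of ℂ g₁.part g₂.part).symm x))) = _
    rw [h, map_smul, map_smul]
    rfl

end FermiProduct

end Fermi

section States

variable {B : Type w} [Ring B] [StarRing B] [Algebra ℂ B]

/-- A state on a unital `*`-algebra: a unital linear functional, positive on the elements
`b* b`. -/
structure IsState (φ : B →ₗ[ℂ] ℂ) : Prop where
  map_one : φ 1 = 1
  nonneg : ∀ b, 0 ≤ φ (star b * b)

/-- An even state of a `ℤ₂`-graded `*`-algebra: a state that is invariant under the grading. -/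
structure IsEvenState (g : Z2Grading B) (φ : B →ₗ[ℂ] ℂ) : Prop extends IsState φ where
  even : ∀ b, φ (g.θ b) = φ b

/-- A GNS representation of a functional `φ` on a unital `*`-algebra: a `*`-representation `π` by
bounded operators on a Hilbert space, with a cyclic vector `ξ` such that `φ b = ⟪ξ, π b ξ⟫`. It is
unique up to unitary equivalence. -/
structure GNSRepresentation (φ : B →ₗ[ℂ] ℂ) where
  H : Type w
  [normedAddCommGroup : NormedAddCommGroup H]
  [innerProductSpace : InnerProductSpace ℂ H]
  [completeSpace : CompleteSpace H]
  π : B →⋆ₐ[ℂ] (H →L[ℂ] H)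
  ξ : H
  cyclic : Dense (Set.range fun b => π b ξ)
  apply_eq : ∀ b, φ b = inner ℂ ξ (π b ξ)

attribute [instance] GNSRepresentation.normedAddCommGroup GNSRepresentation.innerProductSpace
  GNSRepresentation.completeSpace

/-- A C*-norm on a `*`-algebra. -/
structure IsCStarNorm (p : B → ℝ) : Prop where
  nonneg : ∀ x, 0 ≤ p x
  add_le : ∀ x y, p (x + y) ≤ p x + p y
  smul_eq : ∀ (c : ℂ) x, p (c • x) = ‖c‖ * p x
  mul_le : ∀ x y, p (x * y) ≤ p x * p y
  star_mul_self : ∀ x, p (star x * x) = p x ^ 2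
  eq_zero : ∀ x, p x = 0 → x = 0

end States

namespace FermiProduct

variable {A₁ : Type u} {A₂ : Type v} [CStarAlgebra A₁] [CStarAlgebra A₂]
  (g₁ : Z2Grading A₁) (g₂ : Z2Grading A₂)

/-- The product functional `ω₁ × ω₂`, with `(ω₁ × ω₂) (a ⊗ b) = ω₁ a * ω₂ b`. -/
def prodFunctional (ω₁ : A₁ →ₗ[ℂ] ℂ) (ω₂ : A₂ →ₗ[ℂ] ℂ) : FermiProduct g₁ g₂ →ₗ[ℂ] ℂ :=
  LinearMap.mul' ℂ ℂ ∘ₗ TensorProduct.map ω₁ ω₂ ∘ₗ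
    (GradedTensorProduct.of ℂ g₁.part g₂.part).symm.toLinearMap

/-- The numbers `‖π x‖`, with `π` the GNS representation of a product of even states. -/
def spatialValues (x : FermiProduct g₁ g₂) : Set ℝ :=
  {r | ∃ (ω₁ : A₁ →ₗ[ℂ] ℂ) (ω₂ : A₂ →ₗ[ℂ] ℂ), IsEvenState g₁ ω₁ ∧ IsEvenState g₂ ω₂ ∧
    ∃ ρ : GNSRepresentation (prodFunctional g₁ g₂ ω₁ ω₂), r = ‖ρ.π x‖}

/-- The spatial (semi)norm `‖x‖_min`. -/
def spatialNorm (x : FermiProduct g₁ g₂) : ℝ := sSup (spatialValues g₁ g₂ x)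

end FermiProduct

end

/-!
Evenness of `ω₁` makes `(ω₁ × ω₂) (x* y)` insensitive to the signs: on homogeneous elementary
tensors `x = a ⊗ b` and `y = c ⊗ d`, either `a` and `c` have the same parity and all signs cancel,
or `a* c` is odd and `ω₁ (a* c) = 0`. Hence `(ω₁ × ω₂) (x* y)` is the value of the ordinary
functional `ω₁ ⊗ ω₂` at `x* y`, formed in the ungraded tensor product `A₁ ⊗ A₂`, where positivity is
the Schur product theorem for the Gram matrices of `ω₁` and `ω₂`.

Left multiplication by `a ⊗ 1` is bounded on the GNS space of any positive functional `φ`: apply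
`ψ (a* a) ≤ ‖a‖² ψ 1` to the positive functional `ψ c = φ (x* (c ⊗ 1) x)` on the C*-algebra `A₁`.
The same holds for `1 ⊗ b`, and these elements generate the Fermi product.

The supremum `‖x‖_min` is the norm of `x` in the direct sum of the GNS representations, so that
only faithfulness remains. Averaging Hahn–Banach functionals over the grading gives enough even
states for the functionals `ω (c · )` to separate the points of `A₁` and `A₂`, and products of
separating families separate the points of `A₁ ⊗ A₂`.
-/

noncomputable section

section PositiveFunctionals

variable {B : Type w} [Ring B] [StarRing B] [Algebra ℂ B]

/-- A positive linear functional on a `*`-algebra. Since the algebra need not be ordered, positivity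
refers to the elements `b* b`. -/
def IsPositiveFunctional (φ : B →ₗ[ℂ] ℂ) : Prop := ∀ b, 0 ≤ φ (star b * b)

theorem IsState.isPositiveFunctional {φ : B →ₗ[ℂ] ℂ} (hφ : IsState φ) : IsPositiveFunctional φ :=
  hφ.nonneg

namespace IsPositiveFunctional

variable {φ ψ : B →ₗ[ℂ] ℂ}

theorem add (hφ : IsPositiveFunctional φ) (hψ : IsPositiveFunctional ψ) :
    IsPositiveFunctional (φ + ψ) := fun b => add_nonneg (hφ b) (hψ b)

theorem apply_one_nonneg (hφ : IsPositiveFunctional φ) : 0 ≤ φ 1 := by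
  simpa only [star_one, mul_one] using hφ 1

theorem isState_inv_smul (hφ : IsPositiveFunctional φ) (h1 : φ 1 ≠ 0) :
    IsState ((φ 1)⁻¹ • φ) where
  map_one := inv_mul_cancel₀ h1
  nonneg b := mul_nonneg (inv_nonneg.2 hφ.apply_one_nonneg) (hφ b)

theorem comp_starAlgHom {A : Type*} [Ring A] [StarRing A] [Algebra ℂ A]
    (hφ : IsPositiveFunctional φ) (f : A →⋆ₐ[ℂ] B) :
    IsPositiveFunctional (φ ∘ₗ f.toAlgHom.toLinearMap) := fun a => by
  have hfa := hφ (f a)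
  rwa [← map_star, ← map_mul] at hfa

theorem comp_mulLeftRight_star (hφ : IsPositiveFunctional φ) (x : B) :
    IsPositiveFunctional (φ ∘ₗ LinearMap.mulLeftRight ℂ (star x, x)) := fun b => by
  simpa only [star_mul, mul_assoc, LinearMap.comp_apply, LinearMap.mulLeftRight_apply]
    using hφ (b * x)

section CStarAlgebra

variable {A : Type*} [CStarAlgebra A] {ω : A →ₗ[ℂ] ℂ}

theorem apply_star_mul_self_le (hω : IsPositiveFunctional ω) (a : A) :
    ω (star a * a) ≤ (‖a‖ ^ 2 : ℝ) * ω 1 := by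
  let _ := CStarAlgebra.spectralOrder A
  let _ := CStarAlgebra.spectralOrderedRing A
  obtain ⟨c, hc⟩ := CStarAlgebra.nonneg_iff_eq_star_mul_self.1
    (sub_nonneg.2 (CStarAlgebra.star_mul_le_algebraMap_norm_sq (a := a)))
  have hωc := hω c
  rw [← hc, map_sub, Algebra.algebraMap_eq_smul_one, ← Complex.coe_smul, map_smul] at hωc
  exact sub_nonneg.1 hωc

theorem apply_one_ne_zero (hω : IsPositiveFunctional ω) {a : A}
    (ha : ω (star a * a) ≠ 0) : ω 1 ≠ 0 := fun h1 =>
  ha <| le_antisymm (by simpa only [h1, mul_zero] using hω.apply_star_mul_self_le a) (hω a)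

theorem apply_star_map_mul_self_le (hφ : IsPositiveFunctional φ) (f : A →⋆ₐ[ℂ] B)
    (a : A) (x : B) :
    φ (star (f a * x) * (f a * x)) ≤ (‖a‖ ^ 2 : ℝ) * φ (star x * x) := by
  have hle := ((hφ.comp_mulLeftRight_star x).comp_starAlgHom f).apply_star_mul_self_le a
  simpa [mul_assoc, StarHomClass.map_star] using! hle

end CStarAlgebra

variable [StarModule ℂ B]

theorem map_star (hφ : IsPositiveFunctional φ) (b : B) : φ (star b) = star (φ b) := by
  have him : ∀ c, (φ (star c * c)).im = 0 := fun c => (Complex.le_def.1 (hφ c)).2.symm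
  have h0 : (φ 1).im = 0 := (Complex.le_def.1 hφ.apply_one_nonneg).2.symm
  have hb := him b
  have h1 := him (1 + b)
  have hI := him (1 + Complex.I • b)
  simp only [star_add, star_one, add_mul, mul_add, one_mul, mul_one, map_add, star_smul,
    smul_mul_smul_comm, map_smul, Complex.add_im, smul_eq_mul, Complex.mul_im, Complex.mul_re,
    Complex.I_re, Complex.I_im, Complex.star_def, Complex.conj_I, Complex.neg_re,
    Complex.neg_im] at h1 hI
  apply Complex.ext
  · simp only [Complex.star_def, Complex.conj_re]; linarith
  · simp only [Complex.star_def, Complex.conj_im]; linarith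

theorem posSemidef_gram (hφ : IsPositiveFunctional φ) {ι : Type*} [Finite ι] (b : ι → B) :
    (Matrix.of fun i j => φ (star (b i) * b j)).PosSemidef := by
  cases nonempty_fintype ι
  refine Matrix.posSemidef_iff_dotProduct_mulVec.2 ⟨?_, fun x => ?_⟩
  · ext i j
    simp only [Matrix.conjTranspose_apply, Matrix.of_apply, ← hφ.map_star, star_mul, star_star]
  · refine (hφ (∑ i, x i • b i)).trans_eq ?_
    rw [star_sum, Finset.sum_mul_sum]
    simp only [star_smul, map_sum, dotProduct, Matrix.mulVec, Matrix.of_apply, Pi.star_apply,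
      smul_mul_smul_comm, map_smul, smul_eq_mul, Finset.mul_sum]
    exact Finset.sum_congr rfl fun i _ => Finset.sum_congr rfl fun j _ => by ring

theorem dualDistrib_tmul {A : Type*} [Ring A] [StarRing A] [Algebra ℂ A] [StarModule ℂ A]
    {ω : A →ₗ[ℂ] ℂ} (hω : IsPositiveFunctional ω) (hφ : IsPositiveFunctional φ) :
    IsPositiveFunctional (TensorProduct.dualDistrib ℂ A B (ω ⊗ₜ φ)) := fun t => by
  obtain ⟨n, a, b, rfl⟩ := TensorProduct.exists_sum_tmul_eq t
  have hschur := ((hω.posSemidef_gram a).hadamard (hφ.posSemidef_gram b)).dotProduct_mulVec_nonneg 1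
  refine hschur.trans_eq ?_
  simp only [star_sum, TensorProduct.star_tmul, Finset.sum_mul_sum,
    Algebra.TensorProduct.tmul_mul_tmul, map_sum, TensorProduct.dualDistrib_apply,
    dotProduct, Matrix.mulVec, Matrix.hadamard_apply, Matrix.of_apply, Pi.star_apply,
    Pi.one_apply, star_one, one_mul, mul_one]

end IsPositiveFunctional

end PositiveFunctionals

section GNSConstruction

open UniformSpace

variable {B : Type w} [Ring B] [StarRing B] [Algebra ℂ B] [StarModule ℂ B] {φ : B →ₗ[ℂ] ℂ}

/-- The `*`-algebra `B`, regarded as a pre-Hilbert space with the semi-inner product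
`⟪a, b⟫ = φ (a* b)` of a positive functional `φ`. It is a type synonym, because `B` may already
carry a norm. -/
def PreGNSSpace (_ : IsPositiveFunctional φ) : Type w := B

namespace PreGNSSpace

variable (hφ : IsPositiveFunctional φ)

instance : AddCommGroup (PreGNSSpace hφ) := inferInstanceAs (AddCommGroup B)

instance : Module ℂ (PreGNSSpace hφ) := inferInstanceAs (Module ℂ B)

/-- The identity map from the algebra to its pre-Hilbert space. -/
def of : B ≃ₗ[ℂ] PreGNSSpace hφ := LinearEquiv.refl ℂ B

/-- The semi-inner product `⟪a, b⟫ = φ (a* b)`, which may be degenerate. -/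
abbrev core : PreInnerProductSpace.Core ℂ (PreGNSSpace hφ) where
  inner a b := φ (star ((of hφ).symm a) * (of hφ).symm b)
  conj_inner_symm a b := by rw [← Complex.star_def, ← hφ.map_star, star_mul, star_star]
  re_inner_nonneg a := (Complex.le_def.1 (hφ _)).1
  add_left a b c := by rw [map_add, star_add, add_mul, map_add]
  smul_left a b c := by simp

instance : SeminormedAddCommGroup (PreGNSSpace hφ) :=
  InnerProductSpace.Core.toSeminormedAddCommGroup (c := core hφ)

instance : InnerProductSpace ℂ (PreGNSSpace hφ) := InnerProductSpace.ofCore (core hφ)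

theorem inner_of (a b : B) : inner ℂ (of hφ a) (of hφ b) = φ (star a * b) := rfl

theorem norm_of_sq (a : B) : ((‖of hφ a‖ ^ 2 : ℝ) : ℂ) = φ (star a * a) := by
  rw [← inner_of hφ, inner_self_eq_norm_sq_to_K]
  simp

/-- The elements of `B` by which left multiplication is bounded for the seminorm of `φ`. Boundedness
is encoded by a continuous linear operator that implements the left multiplication. -/
def leftBounded : Subalgebra ℂ B where
  carrier := {y | ∃ T : PreGNSSpace hφ →L[ℂ] PreGNSSpace hφ, ∀ x, T (of hφ x) = of hφ (y * x)}
  mul_mem' := by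
    rintro y z ⟨S, hS⟩ ⟨T, hT⟩
    exact ⟨S ∘L T, fun x => by rw [ContinuousLinearMap.comp_apply, hT, hS, mul_assoc]⟩
  add_mem' := by
    rintro y z ⟨S, hS⟩ ⟨T, hT⟩
    exact ⟨S + T, fun x => by rw [add_apply, hS, hT, add_mul, map_add]⟩
  algebraMap_mem' c := ⟨c • 1, fun x => by
    rw [Algebra.algebraMap_eq_smul_one, smul_one_mul, map_smul]; rfl⟩

theorem norm_of_map_mul_le {A : Type*} [CStarAlgebra A] (f : A →⋆ₐ[ℂ] B) (a : A) (x : B) :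
    ‖of hφ (f a * x)‖ ≤ ‖a‖ * ‖of hφ x‖ := by
  refine (sq_le_sq₀ (norm_nonneg _) (by positivity)).1 ?_
  rw [mul_pow, ← Complex.real_le_real, Complex.ofReal_mul, norm_of_sq, norm_of_sq]
  exact hφ.apply_star_map_mul_self_le f a x

theorem range_le_leftBounded {A : Type*} [CStarAlgebra A] (f : A →⋆ₐ[ℂ] B) :
    f.toAlgHom.range ≤ leftBounded hφ := by
  rintro _ ⟨a, rfl⟩
  let T := (of hφ).toLinearMap ∘ₗ LinearMap.mulLeft ℂ (f a) ∘ₗ (of hφ).symm.toLinearMap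
  exact ⟨T.mkContinuous ‖a‖ fun x => norm_of_map_mul_le hφ f a ((of hφ).symm x), fun _ => rfl⟩

variable {hφ} (hb : leftBounded hφ = ⊤)

/-- Left multiplication by `y` as a bounded operator on the pre-Hilbert space. -/
def leftMul (y : B) : PreGNSSpace hφ →L[ℂ] PreGNSSpace hφ :=
  (show y ∈ leftBounded hφ from hb ▸ Algebra.mem_top).choose

theorem leftMul_of (y x : B) : leftMul hb y (of hφ x) = of hφ (y * x) :=
  (show y ∈ leftBounded hφ from hb ▸ Algebra.mem_top).choose_spec x

theorem completion_leftMul_coe (y x : B) :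
    (leftMul hb y).completion (of hφ x : Completion (PreGNSSpace hφ)) = of hφ (y * x) := by
  rw [ContinuousLinearMap.completion_apply_coe, leftMul_of]

theorem completion_hom_ext {S T : Completion (PreGNSSpace hφ) →L[ℂ] Completion (PreGNSSpace hφ)}
    (h : ∀ x : B, S (of hφ x) = T (of hφ x)) : S = T :=
  DFunLike.coe_injective <| Completion.ext S.continuous T.continuous h

/-- The representation of `B` by left multiplication on the Hilbert space of `φ`. -/
def rep : B →⋆ₐ[ℂ] (Completion (PreGNSSpace hφ) →L[ℂ] Completion (PreGNSSpace hφ)) where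
  toAlgHom := AlgHom.ofLinearMap
    { toFun y := (leftMul hb y).completion
      map_add' y z := completion_hom_ext fun x => by
        simp only [add_apply, completion_leftMul_coe, add_mul, map_add, Completion.coe_add]
      map_smul' c y := completion_hom_ext fun x => by
        simp only [smul_apply, completion_leftMul_coe, smul_mul_assoc, map_smul,
          Completion.coe_smul, RingHom.id_apply] }
    (completion_hom_ext fun x => (completion_leftMul_coe hb 1 x).trans (by rw [one_mul]; rfl))
    (fun y z => completion_hom_ext fun x => by
      change (leftMul hb (y * z)).completion _ =
        (leftMul hb y).completion ((leftMul hb z).completion _)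
      simp only [completion_leftMul_coe, mul_assoc])
  map_star' y := by
    refine (ContinuousLinearMap.eq_adjoint_iff (leftMul hb (star y)).completion
      (leftMul hb y).completion).2 fun ξ η => ?_
    induction ξ, η using Completion.induction_on₂ with
    | hp => apply isClosed_eq <;> fun_prop
    | ih ξ η =>
      obtain ⟨x, rfl⟩ := (of hφ).surjective ξ
      obtain ⟨z, rfl⟩ := (of hφ).surjective η
      rw [completion_leftMul_coe, completion_leftMul_coe, Completion.inner_coe,
        Completion.inner_coe, inner_of, inner_of, star_mul, star_star, mul_assoc]

theorem rep_coe (y x : B) :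
    rep hb y (of hφ x : Completion (PreGNSSpace hφ)) = of hφ (y * x) :=
  completion_leftMul_coe hb y x

theorem dense_range_rep_one :
    Dense (Set.range fun y => rep hb y (of hφ 1 : Completion (PreGNSSpace hφ))) := by
  simp only [rep_coe, mul_one]
  exact Completion.denseRange_coe.comp (of hφ).surjective.denseRange (Completion.continuous_coe _)

/-- The GNS representation of a positive functional for which all left multiplications are
bounded. -/
def gns : GNSRepresentation φ where
  H := Completion (PreGNSSpace hφ)
  π := rep hb
  ξ := of hφ 1
  cyclic := dense_range_rep_one hb
  apply_eq b := by
    rw [rep_coe, Completion.inner_coe, inner_of, mul_one, star_one, one_mul]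

end PreGNSSpace

end GNSConstruction

section EnoughStates

section ComplexExtension

variable {E : Type*} [AddCommGroup E] [Module ℂ E] [StarAddMonoid E] [StarModule ℂ E]

open scoped ComplexStarModule

/-- The `ℂ`-linear extension `a ↦ f (ℜ a) + i f (ℑ a)` of the restriction of `f` to the
self-adjoint elements. -/
def hermitianExtension (f : E →ₗ[ℝ] ℝ) : E →ₗ[ℂ] ℂ where
  toFun a := f (ℜ a) + f (ℑ a) * Complex.I
  map_add' a b := by
    simp only [map_add, AddSubgroup.coe_add, Complex.ofReal_add]
    ring
  map_smul' c a := by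
    simp only [realPart_smul, imaginaryPart_smul, AddSubgroup.coe_sub, AddSubgroup.coe_add,
      selfAdjoint.val_smul, map_sub, map_add, map_smul, smul_eq_mul, RingHom.id_apply,
      Complex.ofReal_sub, Complex.ofReal_add, Complex.ofReal_mul]
    linear_combination ((f (ℜ a) : ℂ) + f (ℑ a) * Complex.I) * (Complex.re_add_im c) -
      (c.im : ℂ) * f (ℑ a) * Complex.I_sq

theorem hermitianExtension_of_isSelfAdjoint (f : E →ₗ[ℝ] ℝ) {a : E} (ha : IsSelfAdjoint a) :
    hermitianExtension f a = f a := by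
  change (f (ℜ a) + f (ℑ a) * Complex.I : ℂ) = f a
  rw [ha.coe_realPart, ha.imaginaryPart]
  simp

end ComplexExtension

variable {A : Type u} [CStarAlgebra A]

theorem exists_isPositiveFunctional_star_mul_self_ne_zero {a : A} (ha : a ≠ 0) :
    ∃ ψ : A →ₗ[ℂ] ℂ, IsPositiveFunctional ψ ∧ ψ (star a * a) ≠ 0 := by
  let _ := CStarAlgebra.spectralOrder A
  let _ := CStarAlgebra.spectralOrderedRing A
  have hmem : -(star a * a) ∉ ProperCone.positive ℝ A := fun hneg => ha <|
    CStarRing.star_mul_self_eq_zero_iff a |>.1 <|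
      le_antisymm (neg_nonneg.1 (ProperCone.mem_positive.1 hneg)) (star_mul_self_nonneg a)
  obtain ⟨f, hf, hfa⟩ := ProperCone.hyperplane_separation_point _ hmem
  have hext (b : A) : hermitianExtension f.toLinearMap (star b * b) = f (star b * b) :=
    hermitianExtension_of_isSelfAdjoint _ (.star_mul_self b)
  refine ⟨hermitianExtension f.toLinearMap, fun b => ?_, ?_⟩
  · rw [hext, Complex.zero_le_real]
    exact hf _ (ProperCone.mem_positive.2 (star_mul_self_nonneg b))
  · rw [hext, Complex.ofReal_ne_zero]
    rw [map_neg, neg_lt_zero] at hfa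
    exact hfa.ne'

theorem exists_isEvenState_star_mul_self_ne_zero (g : Z2Grading A) {a : A} (ha : a ≠ 0) :
    ∃ ω, IsEvenState g ω ∧ ω (star a * a) ≠ 0 := by
  obtain ⟨ψ, hψ, hψa⟩ := exists_isPositiveFunctional_star_mul_self_ne_zero ha
  have hψθ := hψ.comp_starAlgHom (g.θ : A →⋆ₐ[ℂ] A)
  set χ := ψ + ψ ∘ₗ (g.θ : A →⋆ₐ[ℂ] A).toAlgHom.toLinearMap
  have hχ : IsPositiveFunctional χ := hψ.add hψθ
  have hχa : χ (star a * a) ≠ 0 :=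
    (add_pos_of_pos_of_nonneg ((hψ a).lt_of_ne' hψa) (hψθ a)).ne'
  have hχθ (b : A) : χ (g.θ b) = χ b := by simp [χ, g.involutive, add_comm]
  have hχ1 : χ 1 ≠ 0 := hχ.apply_one_ne_zero hχa
  exact ⟨(χ 1)⁻¹ • χ,
    { hχ.isState_inv_smul hχ1 with even b := congrArg ((χ 1)⁻¹ * ·) (hχθ b) },
    mul_ne_zero (inv_ne_zero hχ1) hχa⟩

end EnoughStates

section TensorProductDual

variable {R V W : Type*} [CommRing R] [AddCommGroup V] [Module R V] [AddCommGroup W] [Module R W]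

theorem eq_zero_of_forall_rid_lTensor_eq_zero [Module.Free R W] {t : V ⊗[R] W}
    (h : ∀ f : Module.Dual R W, TensorProduct.rid R V (f.lTensor V t) = 0) : t = 0 := by
  classical
  let 𝓑 := Module.Free.chooseBasis R W
  refine (TensorProduct.equivFinsuppOfBasisRight 𝓑).map_eq_zero_iff.1 (Finsupp.ext fun i => ?_)
  rw [TensorProduct.equivFinsuppOfBasisRight_apply, h, Finsupp.zero_apply]

theorem apply_lid_rTensor_eq_dualDistrib (f : Module.Dual R V) (g : Module.Dual R W)
    (t : V ⊗[R] W) :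
    g (TensorProduct.lid R W (f.rTensor W t)) = TensorProduct.dualDistrib R V W (f ⊗ₜ g) t := by
  induction t using TensorProduct.induction_on with
  | zero => simp only [map_zero]
  | tmul v w => simp
  | add s t hs ht => simp only [map_add, hs, ht]

theorem apply_rid_lTensor_eq_dualDistrib (f : Module.Dual R V) (g : Module.Dual R W)
    (t : V ⊗[R] W) :
    f (TensorProduct.rid R V (g.lTensor V t)) = TensorProduct.dualDistrib R V W (f ⊗ₜ g) t := by
  induction t using TensorProduct.induction_on with
  | zero => simp only [map_zero]
  | tmul v w => simp [mul_comm]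
  | add s t hs ht => simp only [map_add, hs, ht]

theorem eq_zero_of_forall_dualDistrib_tmul_eq_zero [Module.Free R W] {S : Set (Module.Dual R V)}
    {T : Set (Module.Dual R W)} (hS : ∀ v, (∀ f ∈ S, f v = 0) → v = 0)
    (hT : ∀ w, (∀ g ∈ T, g w = 0) → w = 0) {t : V ⊗[R] W}
    (h : ∀ f ∈ S, ∀ g ∈ T, TensorProduct.dualDistrib R V W (f ⊗ₜ g) t = 0) : t = 0 := by
  have hslice : ∀ f ∈ S, TensorProduct.lid R W (f.rTensor W t) = 0 := fun f hf =>
    hT _ fun g hg => (apply_lid_rTensor_eq_dualDistrib f g t).trans (h f hf g hg)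
  refine eq_zero_of_forall_rid_lTensor_eq_zero fun g => hS _ fun f hf => ?_
  rw [apply_rid_lTensor_eq_dualDistrib, ← apply_lid_rTensor_eq_dualDistrib, hslice f hf, map_zero]

end TensorProductDual

section EvenSeparation

variable {A₁ : Type u} {A₂ : Type v} [CStarAlgebra A₁] [CStarAlgebra A₂]

/-- The functionals `ω (c · )`, with `ω` an even state: they separate points, whereas the even
states themselves all vanish on the odd part. -/
def evenStateTranslates {A : Type*} [Ring A] [StarRing A] [Algebra ℂ A] (g : Z2Grading A) :
    Set (Module.Dual ℂ A) :=
  {f | ∃ ω c, IsEvenState g ω ∧ f = ω ∘ₗ LinearMap.mulLeft ℂ c}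

theorem eq_zero_of_forall_mem_evenStateTranslates (g : Z2Grading A₁) {a : A₁}
    (h : ∀ f ∈ evenStateTranslates g, f a = 0) : a = 0 := by
  by_contra ha
  obtain ⟨ω, hω, hωa⟩ := exists_isEvenState_star_mul_self_ne_zero g ha
  exact hωa (h _ ⟨ω, star a, hω, rfl⟩)

theorem eq_zero_of_forall_isEvenState_dualDistrib_mul (g₁ : Z2Grading A₁) (g₂ : Z2Grading A₂)
    {t : A₁ ⊗[ℂ] A₂}
    (h : ∀ ω₁ ω₂, IsEvenState g₁ ω₁ → IsEvenState g₂ ω₂ →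
      ∀ s, TensorProduct.dualDistrib ℂ A₁ A₂ (ω₁ ⊗ₜ ω₂) (s * t) = 0) : t = 0 := by
  refine eq_zero_of_forall_dualDistrib_tmul_eq_zero
    (fun _ => eq_zero_of_forall_mem_evenStateTranslates g₁)
    (fun _ => eq_zero_of_forall_mem_evenStateTranslates g₂) ?_
  rintro _ ⟨ω₁, c₁, h₁, rfl⟩ _ ⟨ω₂, c₂, h₂, rfl⟩
  have htranslate : TensorProduct.dualDistrib ℂ A₁ A₂
        ((ω₁ ∘ₗ LinearMap.mulLeft ℂ c₁) ⊗ₜ (ω₂ ∘ₗ LinearMap.mulLeft ℂ c₂)) =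
      TensorProduct.dualDistrib ℂ A₁ A₂ (ω₁ ⊗ₜ ω₂) ∘ₗ LinearMap.mulLeft ℂ (c₁ ⊗ₜ c₂) :=
    TensorProduct.ext' fun a b => by simp
  rw [htranslate]
  exact h ω₁ ω₂ h₁ h₂ (c₁ ⊗ₜ c₂)

end EvenSeparation

section CStarNorms

variable {B : Type w} [Ring B] [StarRing B] [Algebra ℂ B]

theorem isCStarNorm_norm_of_injective {D : Type*} [NonUnitalNormedRing D] [StarRing D]
    [CStarRing D] [NormedSpace ℂ D] (π : B →⋆ₙₐ[ℂ] D) (hπ : Function.Injective π) :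
    IsCStarNorm fun x => ‖π x‖ where
  nonneg x := norm_nonneg (π x)
  add_le x y := by simpa only [map_add] using norm_add_le (π x) (π y)
  smul_eq c x := by rw [map_smul, norm_smul]
  mul_le x y := by simpa only [map_mul] using norm_mul_le (π x) (π y)
  star_mul_self x := by rw [map_mul, map_star, CStarRing.norm_star_mul_self, sq]
  eq_zero x hx := (map_eq_zero_iff π hπ).1 (norm_eq_zero.1 hx)

open scoped lp ENNReal

variable {ι : Type*} {D : ι → Type*} [∀ i, NonUnitalNormedRing (D i)] [∀ i, StarRing (D i)]
  [∀ i, CStarRing (D i)] [∀ i, NormedSpace ℂ (D i)]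

/-- The direct sum of a pointwise bounded family of `*`-homomorphisms. -/
def directSumHom (π : ∀ i, B →⋆ₙₐ[ℂ] D i) (hπ : ∀ x, BddAbove (Set.range fun i => ‖π i x‖)) :
    B →⋆ₙₐ[ℂ] lp D ∞ where
  toFun x := ⟨fun i => π i x, memℓp_infty (hπ x)⟩
  map_smul' c x := lp.ext <| funext fun i => map_smul (π i) c x
  map_zero' := lp.ext <| funext fun i => map_zero (π i)
  map_add' x y := lp.ext <| funext fun i => map_add (π i) x y
  map_mul' x y := lp.ext <| funext fun i => map_mul (π i) x y
  map_star' x := lp.ext <| funext fun i => map_star (π i) x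

theorem isCStarNorm_iSup_norm (π : ∀ i, B →⋆ₙₐ[ℂ] D i)
    (hbdd : ∀ x, BddAbove (Set.range fun i => ‖π i x‖))
    (hfaithful : ∀ x, (∀ i, π i x = 0) → x = 0) : IsCStarNorm fun x => ⨆ i, ‖π i x‖ := by
  have hinj : Function.Injective (directSumHom π hbdd) :=
    (injective_iff_map_eq_zero _).2 fun x hx =>
      hfaithful x fun i => congrFun (congrArg Subtype.val hx) i
  have hnorm (x : B) : ‖directSumHom π hbdd x‖ = ⨆ i, ‖π i x‖ := lp.norm_eq_ciSup _
  simpa only [hnorm] using isCStarNorm_norm_of_injective _ hinj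

end CStarNorms

theorem Z2Grading.apply_eq_zero_of_mem_part_one {B : Type w} [Ring B] [StarRing B] [Algebra ℂ B]
    {g : Z2Grading B} {ω : B →ₗ[ℂ] ℂ} (hω : ∀ b, ω (g.θ b) = ω b) {b : B} (hb : b ∈ g.part 1) :
    ω b = 0 := by
  have hneg := hω b
  rw [g.mem_part_one.1 hb, map_neg] at hneg
  exact self_eq_neg.1 hneg.symm

namespace FermiProduct

open GradedTensorProduct (tmul_coe_mul_coe_tmul)

section Inclusions

variable {A₁ : Type u} {A₂ : Type v} [Ring A₁] [StarRing A₁] [Algebra ℂ A₁] [StarModule ℂ A₁]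
  [Ring A₂] [StarRing A₂] [Algebra ℂ A₂] [StarModule ℂ A₂]
  {g₁ : Z2Grading A₁} {g₂ : Z2Grading A₂}

theorem star_tmul_one (a : A₁) :
    star (a ᵍ⊗ₜ[ℂ] (1 : A₂) : FermiProduct g₁ g₂) = star a ᵍ⊗ₜ[ℂ] (1 : A₂) := by
  have hom (i : ZMod 2) (c : g₁.part i) :
      star ((c : A₁) ᵍ⊗ₜ[ℂ] (1 : A₂) : FermiProduct g₁ g₂) = star (c : A₁) ᵍ⊗ₜ[ℂ] (1 : A₂) := by
    simpa using star_tmul c (⟨1, SetLike.one_mem_graded g₂.part⟩ : g₂.part 0)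
  induction a using DirectSum.Decomposition.inductionOn g₁.part with
  | zero => simpa using hom 0 0
  | homogeneous c => exact hom _ c
  | add a b ha hb =>
    simp only [GradedTensorProduct.tmul, TensorProduct.add_tmul, map_add, star_add] at ha hb ⊢
    rw [ha, hb]

theorem star_one_tmul (b : A₂) :
    star ((1 : A₁) ᵍ⊗ₜ[ℂ] b : FermiProduct g₁ g₂) = (1 : A₁) ᵍ⊗ₜ[ℂ] star b := by
  have hom (j : ZMod 2) (c : g₂.part j) :
      star ((1 : A₁) ᵍ⊗ₜ[ℂ] (c : A₂) : FermiProduct g₁ g₂) = (1 : A₁) ᵍ⊗ₜ[ℂ] star (c : A₂) := by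
    simpa using star_tmul (⟨1, SetLike.one_mem_graded g₁.part⟩ : g₁.part 0) c
  induction b using DirectSum.Decomposition.inductionOn g₂.part with
  | zero => simpa using hom 0 0
  | homogeneous c => exact hom _ c
  | add a b ha hb =>
    simp only [GradedTensorProduct.tmul, TensorProduct.tmul_add, map_add, star_add] at ha hb ⊢
    rw [ha, hb]

variable (g₁ g₂)

/-- The unital `*`-homomorphism `a ↦ a ⊗ 1`. -/
def inl : A₁ →⋆ₐ[ℂ] FermiProduct g₁ g₂ where
  toAlgHom := GradedTensorProduct.includeLeft g₁.part g₂.part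
  map_star' a := (star_tmul_one a).symm

/-- The unital `*`-homomorphism `b ↦ 1 ⊗ b`. -/
def inr : A₂ →⋆ₐ[ℂ] FermiProduct g₁ g₂ where
  toAlgHom := GradedTensorProduct.includeRight g₁.part g₂.part
  map_star' b := (star_one_tmul b).symm

theorem inl_mul_inr (a : A₁) (b : A₂) :
    inl g₁ g₂ a * inr g₁ g₂ b = (a ᵍ⊗ₜ[ℂ] b : FermiProduct g₁ g₂) :=
  GradedTensorProduct.tmul_one_mul_one_tmul g₁.part g₂.part a b

variable {g₁ g₂}

theorem eq_top_of_range_le {S : Subalgebra ℂ (FermiProduct g₁ g₂)}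
    (hl : (inl g₁ g₂).toAlgHom.range ≤ S) (hr : (inr g₁ g₂).toAlgHom.range ≤ S) : S = ⊤ := by
  refine eq_top_iff.2 fun x _ => ?_
  induction x using induction_homogeneous with
  | zero => exact S.zero_mem
  | add x y hx hy => exact S.add_mem (hx trivial) (hy trivial)
  | tmul i j a b =>
    rw [← inl_mul_inr]
    exact S.mul_mem (hl ⟨a, rfl⟩) (hr ⟨b, rfl⟩)

end Inclusions

variable {A₁ : Type u} {A₂ : Type v} [CStarAlgebra A₁] [CStarAlgebra A₂]
  {g₁ : Z2Grading A₁} {g₂ : Z2Grading A₂} {ω₁ : A₁ →ₗ[ℂ] ℂ} {ω₂ : A₂ →ₗ[ℂ] ℂ}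

theorem prodFunctional_tmul (a : A₁) (b : A₂) :
    prodFunctional g₁ g₂ ω₁ ω₂ (a ᵍ⊗ₜ[ℂ] b) = ω₁ a * ω₂ b := rfl

theorem prodFunctional_star_tmul_mul_tmul (hω₁ : ∀ a, ω₁ (g₁.θ a) = ω₁ a) {i j k : ZMod 2}
    (a : g₁.part i) (b : g₂.part j) (c : g₁.part k) (d : A₂) :
    prodFunctional g₁ g₂ ω₁ ω₂
        (star ((a : A₁) ᵍ⊗ₜ[ℂ] (b : A₂) : FermiProduct g₁ g₂) * ((c : A₁) ᵍ⊗ₜ[ℂ] d)) =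
      ω₁ (star (a : A₁) * c) * ω₂ (star (b : A₂) * d) := by
  rw [star_tmul, smul_mul_assoc, tmul_coe_mul_coe_tmul g₁.part g₂.part
    (star (a : A₁)) ⟨_, g₂.star_mem b.2⟩ c d, smul_smul, Units.smul_def, map_zsmul,
    prodFunctional_tmul]
  rcases eq_or_ne i k with rfl | hik
  · rw [mul_comm j i, Int.units_mul_self, Units.val_one, one_smul]
  · have hodd : i + k = 1 := (by decide : ∀ i k : ZMod 2, i ≠ k → i + k = 1) i k hik
    have hmem : star (a : A₁) * (c : A₁) ∈ g₁.part 1 :=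
      hodd ▸ SetLike.mul_mem_graded (g₁.star_mem a.2) c.2
    rw [Z2Grading.apply_eq_zero_of_mem_part_one hω₁ hmem, zero_mul, smul_zero]

theorem prodFunctional_star_mul (hω₁ : ∀ a, ω₁ (g₁.θ a) = ω₁ a) (x y : FermiProduct g₁ g₂) :
    prodFunctional g₁ g₂ ω₁ ω₂ (star x * y) =
      TensorProduct.dualDistrib ℂ A₁ A₂ (ω₁ ⊗ₜ ω₂)
        (star ((GradedTensorProduct.of ℂ g₁.part g₂.part).symm x) *
          (GradedTensorProduct.of ℂ g₁.part g₂.part).symm y) := by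
  induction x using induction_homogeneous with
  | zero => simp only [star_zero, zero_mul, map_zero]
  | add x x' hx hx' => simp only [star_add, add_mul, map_add, hx, hx']
  | tmul i j a b =>
    induction y using induction_homogeneous with
    | zero => simp only [mul_zero, map_zero]
    | add y y' hy hy' => simp only [mul_add, map_add, hy, hy']
    | tmul k l c d =>
      rw [prodFunctional_star_tmul_mul_tmul hω₁, GradedTensorProduct.of_symm_of,
        GradedTensorProduct.of_symm_of, TensorProduct.star_tmul,
        Algebra.TensorProduct.tmul_mul_tmul, TensorProduct.dualDistrib_apply]

theorem isPositiveFunctional_prodFunctional (hω₁ : ∀ a, ω₁ (g₁.θ a) = ω₁ a)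
    (h₁ : IsPositiveFunctional ω₁) (h₂ : IsPositiveFunctional ω₂) :
    IsPositiveFunctional (prodFunctional g₁ g₂ ω₁ ω₂) := fun x => by
  rw [prodFunctional_star_mul hω₁]
  exact h₁.dualDistrib_tmul h₂ _

theorem isState_prodFunctional (h₁ : IsEvenState g₁ ω₁) (h₂ : IsState ω₂) :
    IsState (prodFunctional g₁ g₂ ω₁ ω₂) where
  map_one := by
    rw [← GradedTensorProduct.of_one, Algebra.TensorProduct.one_def, prodFunctional_tmul,
      h₁.map_one, h₂.map_one, one_mul]
  nonneg := isPositiveFunctional_prodFunctional h₁.even h₁.toIsState.isPositiveFunctional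
    h₂.isPositiveFunctional

theorem nonempty_gnsRepresentation {φ : FermiProduct g₁ g₂ →ₗ[ℂ] ℂ}
    (hφ : IsPositiveFunctional φ) : Nonempty (GNSRepresentation φ) :=
  ⟨PreGNSSpace.gns <| eq_top_of_range_le (PreGNSSpace.range_le_leftBounded hφ (inl g₁ g₂))
    (PreGNSSpace.range_le_leftBounded hφ (inr g₁ g₂))⟩

theorem exists_norm_map_le (x : FermiProduct g₁ g₂) :
    ∃ C : ℝ, ∀ {D : Type*} [CStarAlgebra D] (π : FermiProduct g₁ g₂ →⋆ₐ[ℂ] D), ‖π x‖ ≤ C := by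
  induction x using induction_homogeneous with
  | zero => exact ⟨0, fun π => by rw [map_zero, norm_zero]⟩
  | add x y hx hy =>
    obtain ⟨C, hC⟩ := hx
    obtain ⟨C', hC'⟩ := hy
    exact ⟨C + C', fun π => by
      rw [map_add]; exact (norm_add_le _ _).trans (add_le_add (hC π) (hC' π))⟩
  | tmul i j a b =>
    refine ⟨‖(a : A₁)‖ * ‖(b : A₂)‖, fun π => ?_⟩
    rw [← inl_mul_inr, map_mul]
    exact (norm_mul_le _ _).trans <| mul_le_mul
      (NonUnitalStarAlgHom.norm_apply_le (π.comp (inl g₁ g₂)) (a : A₁))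
      (NonUnitalStarAlgHom.norm_apply_le (π.comp (inr g₁ g₂)) (b : A₂))
      (norm_nonneg _) (norm_nonneg _)

variable (g₁ g₂) in
/-- A GNS representation of a product of even states: the index type of the supremum that defines
the spatial norm. -/
structure EvenProductGNS where
  ω₁ : A₁ →ₗ[ℂ] ℂ
  ω₂ : A₂ →ₗ[ℂ] ℂ
  even₁ : IsEvenState g₁ ω₁
  even₂ : IsEvenState g₂ ω₂
  gns : GNSRepresentation (prodFunctional g₁ g₂ ω₁ ω₂)

theorem spatialValues_eq_range (x : FermiProduct g₁ g₂) :
    spatialValues g₁ g₂ x = Set.range fun ρ : EvenProductGNS g₁ g₂ => ‖ρ.gns.π x‖ := by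
  ext r
  constructor
  · rintro ⟨ω₁, ω₂, h₁, h₂, ρ, rfl⟩
    exact ⟨⟨ω₁, ω₂, h₁, h₂, ρ⟩, rfl⟩
  · rintro ⟨ρ, rfl⟩
    exact ⟨ρ.ω₁, ρ.ω₂, ρ.even₁, ρ.even₂, ρ.gns, rfl⟩

theorem bddAbove_spatialValues (x : FermiProduct g₁ g₂) : BddAbove (spatialValues g₁ g₂ x) := by
  obtain ⟨C, hC⟩ := exists_norm_map_le x
  rw [spatialValues_eq_range]
  exact ⟨C, Set.forall_mem_range.2 fun ρ => hC ρ.gns.π⟩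

theorem eq_zero_of_forall_evenProductGNS {x : FermiProduct g₁ g₂}
    (hx : ∀ ρ : EvenProductGNS g₁ g₂, ρ.gns.π x = 0) : x = 0 := by
  rw [← (GradedTensorProduct.of ℂ g₁.part g₂.part).symm.map_eq_zero_iff]
  refine eq_zero_of_forall_isEvenState_dualDistrib_mul g₁ g₂ fun ω₁ ω₂ h₁ h₂ s => ?_
  obtain ⟨ρ⟩ := nonempty_gnsRepresentation
    (isState_prodFunctional h₁ h₂.toIsState).isPositiveFunctional
  set y := GradedTensorProduct.of ℂ g₁.part g₂.part (star s)
  have hyx : prodFunctional g₁ g₂ ω₁ ω₂ (star y * x) = 0 := by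
    rw [ρ.apply_eq, map_mul, hx ⟨ω₁, ω₂, h₁, h₂, ρ⟩, mul_zero, zero_apply, inner_zero_right]
  simpa only [prodFunctional_star_mul h₁.even, y, GradedTensorProduct.of_symm_of, star_star]
    using hyx

variable (g₁ g₂) in
theorem isCStarNorm_spatialNorm : IsCStarNorm (spatialNorm g₁ g₂) := by
  have hiSup : spatialNorm g₁ g₂ = fun x => ⨆ ρ : EvenProductGNS g₁ g₂, ‖ρ.gns.π x‖ :=
    funext fun x => congrArg sSup (spatialValues_eq_range x)
  rw [hiSup]
  exact isCStarNorm_iSup_norm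
    (fun ρ : EvenProductGNS g₁ g₂ => ρ.gns.π.toNonUnitalStarAlgHom)
    (fun x => by simpa only [spatialValues_eq_range] using! bddAbove_spatialValues x)
    (fun x => eq_zero_of_forall_evenProductGNS)

end FermiProduct

end

theorem mainTheorem9_general {A₁ : Type u} {A₂ : Type v} [CStarAlgebra A₁] [CStarAlgebra A₂]
    (g₁ : Z2Grading A₁) (g₂ : Z2Grading A₂) :
    (∀ (ω₁ : A₁ →ₗ[ℂ] ℂ) (ω₂ : A₂ →ₗ[ℂ] ℂ), IsEvenState g₁ ω₁ → IsState ω₂ →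
      IsState (FermiProduct.prodFunctional g₁ g₂ ω₁ ω₂) ∧
      Nonempty (GNSRepresentation (FermiProduct.prodFunctional g₁ g₂ ω₁ ω₂))) ∧
    (∀ x : FermiProduct g₁ g₂, BddAbove (FermiProduct.spatialValues g₁ g₂ x)) ∧
    IsCStarNorm (FermiProduct.spatialNorm g₁ g₂) := by
  refine ⟨fun ω₁ ω₂ h₁ h₂ => ?_, FermiProduct.bddAbove_spatialValues,
    FermiProduct.isCStarNorm_spatialNorm g₁ g₂⟩
  have hstate := FermiProduct.isState_prodFunctional (g₂ := g₂) h₁ h₂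
  exact ⟨hstate, FermiProduct.nonempty_gnsRepresentation hstate.isPositiveFunctional⟩

theorem mainTheorem9 {A₁ : Type u} {A₂ : Type v} [CStarAlgebra A₁] [CStarAlgebra A₂]
    (g₁ : Z2Grading A₁) (g₂ : Z2Grading A₂) :
    (∀ (ω₁ : A₁ →ₗ[ℂ] ℂ) (ω₂ : A₂ →ₗ[ℂ] ℂ), IsEvenState g₁ ω₁ → IsEvenState g₂ ω₂ →
      IsState (FermiProduct.prodFunctional g₁ g₂ ω₁ ω₂) ∧
      Nonempty (GNSRepresentation (FermiProduct.prodFunctional g₁ g₂ ω₁ ω₂))) ∧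
    (∀ x : FermiProduct g₁ g₂, BddAbove (FermiProduct.spatialValues g₁ g₂ x)) ∧
    IsCStarNorm (FermiProduct.spatialNorm g₁ g₂) := by
  obtain ⟨hstate, hbdd, hnorm⟩ := mainTheorem9_general g₁ g₂
  exact ⟨fun ω₁ ω₂ h₁ h₂ => hstate ω₁ ω₂ h₁ h₂.toIsState, hbdd, hnorm⟩
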